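/- Identify the set $\mathbb{P}^1$ of directions in the plane with $\mathbb{R}/\pi\mathbb{Z}$, with its arc-length metric, and let $B(\theta,\varepsilon)\subset\mathbb{P}^1$ denote the open ball of radius $\varepsilon$ centered at $\theta$. A set $E\subset\mathbb{R}^2$ is rectifiable if $\mathcal{H}^1$-almost every point of $E$ lies in the union of countably many $C^1$ curves (with regular parametrizations). A tangent field of $E$ is a map $x\mapsto\theta_x$ from $E$ to $\mathbb{P}^1$ such that for every $C^1$ curve $\Gamma$, the tangent direction of $\Gamma$ at $x$ equals $\theta_x$ for $\mathcal{H}^1$-almost every $x\in\Gamma\cap E$. **Theorem (Kakeya needle problem for translations).** Let $E\subset\mathbb{R}^2$ be a rectifiable set with $\mathcal{H}^1(E)<\infty$, let $x\mapsto\theta_x$ be any tangent field of $E$, let $\varepsilon>0$, and let $z\in\mathbb{R}^2$. Then there exist $n\ge 1$, a polygonal path $P=\bigcup_{i=1}^n L_i$ from the origin to $z$ with consecutive line segments $L_i=[q_{i-1},q_i]$, $q_0=0$, $q_n=z$, and directions $\theta_1,\dots,\theta_n\in\mathbb{P}^1$ such that $$\Bigl|\,\bigcup_{i=1}^n\ \bigcup_{p\in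 L_i}\bigl(p+\{x\in E:\ \theta_x\notin B(\theta_i,\varepsilon)\}\bigr)\Bigr|<\varepsilon,$$ where $|\cdot|$ denotes (outer) Lebesgue measure on $\mathbb{R}^2$. -/

import Mathlib

open MeasureTheory Set

noncomputable section

/-- The Euclidean plane. -/
abbrev Plane : Type := EuclideanSpace ℝ (Fin 2)

/-- The space of directions (lines through the origin), identified with `ℝ / πℤ` via the angle.
Its distance is the arc-length distance, i.e. the angle in `[0, π/2]` between two lines. -/
abbrev DirectionSpace : Type := AddCircle Real.pi

/-- The direction of a nonzero vector `v`: its polar angle modulo `π`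
(so `v` and `r • v` have the same direction for `r ≠ 0`). The value at `v = 0` is never used. -/
def direction (v : Plane) : DirectionSpace :=
  ((Complex.arg ⟨v 0, v 1⟩ : ℝ) : AddCircle Real.pi)

/-- `γ` is a (regular) parametrization of a `C¹` curve in the plane. -/
def IsC1Curve (γ : ℝ → Plane) : Prop :=
  ContDiff ℝ 1 γ ∧ ∀ t, deriv γ t ≠ 0

/-- A set is rectifiable if countably many `C¹` curves cover it up to an `ℋ¹`-null set. -/
def IsRectifiable (E : Set Plane) : Prop :=
  ∃ Γ : ℕ → ℝ → Plane, (∀ i, IsC1Curve (Γ i)) ∧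
    Measure.hausdorffMeasure 1 (E \ ⋃ i, range (Γ i)) = 0

/-- `θ` is a tangent field of `E`: for every `C¹` curve, the tangent direction of the curve at `x`
is `θ x` for `ℋ¹`-almost every point `x` of `E` on the curve. Only the values of `θ` on `E`
matter, and they may be arbitrary on an `ℋ¹`-null subset of `E`. -/
def IsTangentField (E : Set Plane) (θ : Plane → DirectionSpace) : Prop :=
  ∀ γ : ℝ → Plane, IsC1Curve γ →
    Measure.hausdorffMeasure 1 {x ∈ E | ∃ t, γ t = x ∧ direction (deriv γ t) ≠ θ x} = 0

end

/-! Sweeping a set whose chords are nearly parallel to `α` along a segment in direction `α` costs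
area proportional to the angular error times the length of the set times that of the segment. Up to
small length, `E` consists of finitely many disjoint compact pieces of short arcs, each with a
direction `u i` known to within `δ`; the small remainder costs at most a constant times its length
times the path length.

For the pieces, a path is built by recursive zigzags (`exists_path_of_directions`). A segment
labelled by its own direction deletes every piece within `ε₁` of it. To control a sector of opening
`x + δ` starting at `α`, replace the segment by many tiny zigzags whose two legs point in the
directions at angles `δ` and `x + δ` from `α`. Each leg is one end of the sector between them, of
opening `x`, and is treated recursively. Pieces with direction within `δ` of `α` are nearly tangent
to the original segment; if the zigzags are fine enough, compactness makes their swept area almost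
that of the segment.

One stage multiplies the length by at most `1 + 2 * δ / sin ε₁`, so about `π / δ` stages multiply it
by at most `exp (2 * π / sin ε₁)`, independent of `δ`. The area of each piece is charged at one
stage and then only multiplied by such factors; the total tends to `0` with `δ`. The last
directions, within `ε₁` of `α` modulo `π`, again follow the original segment at a cost of order
`ε₁`. -/

open scoped Pointwise

/-! ### Plane vectors and cone conditions -/

/-- The unit vector with polar angle `α`. -/
noncomputable def unitVec (α : ℝ) : Plane := !₂[Real.cos α, Real.sin α]

/-- The two-dimensional cross product. -/
noncomputable def cross (v w : Plane) : ℝ := v 0 * w 1 - v 1 * w 0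

/-- All chords of `F` make an angle at most about `κ` with the direction of angle `α`. -/
def ConeCondition (κ α : ℝ) (F : Set Plane) : Prop :=
  ∀ x ∈ F, ∀ y ∈ F, |cross (x - y) (unitVec α)| ≤ κ * ‖x - y‖

@[simp] lemma unitVec_zero_apply (α : ℝ) : unitVec α 0 = Real.cos α := by simp [unitVec]

@[simp] lemma unitVec_one_apply (α : ℝ) : unitVec α 1 = Real.sin α := by simp [unitVec]

lemma norm_sq_plane (v : Plane) : ‖v‖ ^ 2 = v 0 ^ 2 + v 1 ^ 2 := by
  simp [EuclideanSpace.norm_sq_eq, Fin.sum_univ_two]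

lemma norm_unitVec (α : ℝ) : ‖unitVec α‖ = 1 := by
  have h := norm_sq_plane (unitVec α)
  simp only [unitVec_zero_apply, unitVec_one_apply, Real.cos_sq_add_sin_sq] at h
  nlinarith [norm_nonneg (unitVec α)]

lemma norm_smul_unitVec (r α : ℝ) : ‖r • unitVec α‖ = |r| := by
  rw [norm_smul, norm_unitVec, mul_one, Real.norm_eq_abs]

lemma abs_cross_le (v w : Plane) : |cross v w| ≤ ‖v‖ * ‖w‖ := by
  apply abs_le_of_sq_le_sq _ (by positivity)
  rw [mul_pow, norm_sq_plane, norm_sq_plane, cross]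
  nlinarith [sq_nonneg (v 0 * w 0 + v 1 * w 1)]

lemma abs_dot_unitVec_le (v : Plane) (α : ℝ) :
    |v 0 * Real.cos α + v 1 * Real.sin α| ≤ ‖v‖ := by
  apply abs_le_of_sq_le_sq _ (by positivity)
  rw [norm_sq_plane]
  nlinarith [sq_nonneg (v 0 * Real.sin α - v 1 * Real.cos α), Real.sin_sq_add_cos_sq α]

lemma cross_sub_right (v w w' : Plane) : cross v (w - w') = cross v w - cross v w' := by
  simp only [cross, PiLp.sub_apply]; ring

lemma norm_unitVec_sub_le (α β : ℝ) : ‖unitVec α - unitVec β‖ ≤ |α - β| := by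
  apply le_of_sq_le_sq _ (abs_nonneg _)
  rw [norm_sq_plane, sq_abs]
  have h : 1 - (α - β) ^ 2 / 2 ≤ Real.cos (α - β) := Real.one_sub_sq_div_two_le_cos
  rw [Real.cos_sub] at h
  simp only [PiLp.sub_apply, unitVec_zero_apply, unitVec_one_apply]
  nlinarith [Real.sin_sq_add_cos_sq α, Real.sin_sq_add_cos_sq β]

lemma ConeCondition.rotate {κ α β κ' : ℝ} {F : Set Plane} (h : ConeCondition κ α F)
    (hκ : κ + |β - α| ≤ κ') : ConeCondition κ' β F := by
  intro x hx y hy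
  have h1 := h x hx y hy
  have h2 : |cross (x - y) (unitVec β - unitVec α)| ≤ ‖x - y‖ * |β - α| :=
    (abs_cross_le _ _).trans
      (mul_le_mul_of_nonneg_left (norm_unitVec_sub_le _ _) (norm_nonneg _))
  rw [cross_sub_right] at h2
  have h3 : |cross (x - y) (unitVec β)| ≤ |cross (x - y) (unitVec β) -
      cross (x - y) (unitVec α)| + |cross (x - y) (unitVec α)| := by
    simpa using abs_add_le (cross (x - y) (unitVec β) - cross (x - y) (unitVec α))
      (cross (x - y) (unitVec α))
  nlinarith [norm_nonneg (x - y)]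

lemma coneCondition_one (α : ℝ) (F : Set Plane) : ConeCondition 1 α F := by
  intro x _ y _
  simpa [norm_unitVec] using abs_cross_le (x - y) (unitVec α)

/-- Adding a multiple of `π` to the angle changes the cross product only by a sign. -/
lemma ConeCondition.congr {κ α β : ℝ} {F : Set Plane} (h : ConeCondition κ α F)
    (hαβ : (α : DirectionSpace) = (β : DirectionSpace)) : ConeCondition κ β F := by
  have h0 : ((α - β : ℝ) : DirectionSpace) = 0 := by
    rw [AddCircle.coe_sub, hαβ, sub_self]
  obtain ⟨n, hn⟩ := (AddCircle.coe_eq_zero_iff _).1 h0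
  have hα : α = β + n * Real.pi := by
    rw [zsmul_eq_mul] at hn; linarith
  intro x hx y hy
  have h1 := h x hx y hy
  have hc : cross (x - y) (unitVec α) = (-1) ^ n * cross (x - y) (unitVec β) := by
    simp only [cross, unitVec_zero_apply, unitVec_one_apply, hα, Real.sin_add_int_mul_pi,
      Real.cos_add_int_mul_pi]
    ring
  rw [hc, abs_mul] at h1
  simpa using h1

/-! ### Area swept along one segment -/

lemma volume_rectangle_le (α a b A B : ℝ) :
    volume {x : Plane | |x 0 * Real.cos α + x 1 * Real.sin α - a| ≤ A ∧
      |cross x (unitVec α) - b| ≤ B} ≤ ENNReal.ofReal (2 * A) * ENNReal.ofReal (2 * B) := by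
  set M : Matrix (Fin 2) (Fin 2) ℝ :=
    !![Real.cos α, Real.sin α; Real.sin α, -Real.cos α] with hM
  have hdet : LinearMap.det (Matrix.toLin' M) = -1 := by
    rw [LinearMap.det_toLin', hM, Matrix.det_fin_two_of]
    nlinarith [Real.sin_sq_add_cos_sq α]
  set box : Set (Fin 2 → ℝ) := Set.pi univ fun i =>
    Icc ((![a - A, b - B] : Fin 2 → ℝ) i) ((![a + A, b + B] : Fin 2 → ℝ) i)
  have hsub : {x : Plane | |x 0 * Real.cos α + x 1 * Real.sin α - a| ≤ A ∧
      |cross x (unitVec α) - b| ≤ B} ⊆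
      (MeasurableEquiv.toLp 2 (Fin 2 → ℝ)).symm ⁻¹' (Matrix.toLin' M ⁻¹' box) := by
    rintro x ⟨h1, h2⟩
    rw [abs_le] at h1 h2
    simp only [cross, unitVec_zero_apply, unitVec_one_apply] at h2
    simp only [mem_preimage, box, mem_pi, mem_univ, forall_true_left, Fin.forall_fin_two,
      Matrix.toLin'_apply, Matrix.mulVec, dotProduct, Fin.sum_univ_two, hM, Matrix.of_apply,
      Matrix.cons_val_zero, Matrix.cons_val_one, mem_Icc, MeasurableEquiv.coe_toLp_symm]
    refine ⟨⟨?_, ?_⟩, ?_, ?_⟩ <;> linarith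
  refine (measure_mono hsub).trans ?_
  rw [(EuclideanSpace.volume_preserving_symm_measurableEquiv_toLp (Fin 2)).measure_preimage_equiv,
    Measure.addHaar_preimage_linearMap _ (by rw [hdet]; norm_num), hdet]
  simp only [box, volume_pi_pi, Real.volume_Icc, Fin.prod_univ_two, Matrix.cons_val_zero,
    Matrix.cons_val_one]
  apply le_of_eq
  rw [show a + A - (a - A) = 2 * A by ring, show b + B - (b - B) = 2 * B by ring]
  norm_num

/-- Sweeping a set that is nearly tangent to `unitVec α` along that direction covers an area
controlled by its length. -/
lemma volume_segment_add_le {κ α r : ℝ} (hκ : 0 ≤ κ) (hr : r ≠ 0) {F : Set Plane}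
    (hF : ConeCondition κ α F) {m : ENNReal} (hm : Measure.hausdorffMeasure 1 F < m) :
    volume (segment ℝ 0 (r • unitVec α) + F) ≤ ENNReal.ofReal (8 * κ * |r|) * m := by
  have hr' : 0 < |r| := abs_pos.2 hr
  rw [Measure.hausdorffMeasure_apply] at hm
  -- Cover `F` by sets of diameter at most `|r|` with total diameter below `m`. Then sweeping one
  -- cover set stays in a rectangle of half-length `2 * |r|` along `α` and half-width `κ * d` across
  -- it, of area `8 * κ * |r| * d`.
  have h1 := (le_iSup₂ (f := fun (ρ : ENNReal) (_ : 0 < ρ) =>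
    ⨅ (t : ℕ → Set Plane) (_ : F ⊆ ⋃ n, t n) (_ : ∀ n, Metric.ediam (t n) ≤ ρ),
      ∑' n, ⨆ _ : (t n).Nonempty, Metric.ediam (t n) ^ (1 : ℝ)) (ENNReal.ofReal |r|)
      (by simpa using hr')).trans_lt hm
  simp only [iInf_lt_iff] at h1
  obtain ⟨t, ht, hd, hsum⟩ := h1
  have hcov : segment ℝ 0 (r • unitVec α) + F ⊆
      ⋃ n, (segment ℝ 0 (r • unitVec α) + (F ∩ t n)) := by
    rintro _ ⟨p, hp, x, hx, rfl⟩
    obtain ⟨n, hn⟩ := mem_iUnion.1 (ht hx)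
    exact mem_iUnion.2 ⟨n, p, hp, x, ⟨hx, hn⟩, rfl⟩
  have hone : ∀ n, volume (segment ℝ 0 (r • unitVec α) + (F ∩ t n)) ≤
      ENNReal.ofReal (8 * κ * |r|) * ⨆ _ : (t n).Nonempty, Metric.ediam (t n) ^ (1 : ℝ) := by
    intro n
    rcases (F ∩ t n).eq_empty_or_nonempty with h | ⟨x₀, hx₀, hx₀'⟩
    · simp [h]
    have hne : (t n).Nonempty := ⟨x₀, hx₀'⟩
    have hfin : Metric.ediam (t n) ≠ ⊤ := ((hd n).trans_lt ENNReal.ofReal_lt_top).ne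
    set d := (Metric.ediam (t n)).toReal with hd_def
    have hd0 : 0 ≤ d := ENNReal.toReal_nonneg
    have hdr : d ≤ |r| := ENNReal.toReal_le_of_le_ofReal hr'.le (hd n)
    have hsub : segment ℝ 0 (r • unitVec α) + (F ∩ t n) ⊆
        {x : Plane | |x 0 * Real.cos α + x 1 * Real.sin α -
            (x₀ 0 * Real.cos α + x₀ 1 * Real.sin α)| ≤ 2 * |r| ∧
          |cross x (unitVec α) - cross x₀ (unitVec α)| ≤ κ * d} := by
      rintro _ ⟨p, hp, x, ⟨hx, hx'⟩, rfl⟩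
      rw [segment_eq_image] at hp
      obtain ⟨s, ⟨hs0, hs1⟩, rfl⟩ := hp
      have hdist : ‖x - x₀‖ ≤ d := by
        rw [← dist_eq_norm, dist_edist]
        exact ENNReal.toReal_mono hfin (Metric.edist_le_ediam_of_mem hx' hx₀')
      have hdot := abs_dot_unitVec_le (x - x₀) α
      have hcr := hF x hx x₀ hx₀
      simp only [cross, PiLp.sub_apply, unitVec_zero_apply, unitVec_one_apply] at hdot hcr
      refine ⟨?_, ?_⟩
      · simp only [smul_zero, zero_add, PiLp.add_apply, PiLp.smul_apply, unitVec_zero_apply,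
          unitVec_one_apply, smul_eq_mul]
        have hrw : (s * (r * Real.cos α) + x 0) * Real.cos α +
            (s * (r * Real.sin α) + x 1) * Real.sin α -
            (x₀ 0 * Real.cos α + x₀ 1 * Real.sin α) =
            s * r + ((x 0 - x₀ 0) * Real.cos α + (x 1 - x₀ 1) * Real.sin α) := by
          linear_combination s * r * Real.sin_sq_add_cos_sq α
        rw [hrw]
        have h3 : |s * r| ≤ |r| := by
          rw [abs_mul, abs_of_nonneg hs0]
          exact mul_le_of_le_one_left (abs_nonneg _) hs1
        have := abs_add_le (s * r) ((x 0 - x₀ 0) * Real.cos α + (x 1 - x₀ 1) * Real.sin α)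
        linarith
      · simp only [cross, smul_zero, zero_add, PiLp.add_apply, PiLp.smul_apply,
          unitVec_zero_apply, unitVec_one_apply, smul_eq_mul]
        have hrw : (s * (r * Real.cos α) + x 0) * Real.sin α -
            (s * (r * Real.sin α) + x 1) * Real.cos α -
            (x₀ 0 * Real.sin α - x₀ 1 * Real.cos α) =
            (x 0 - x₀ 0) * Real.sin α - (x 1 - x₀ 1) * Real.cos α := by ring
        rw [hrw]
        exact hcr.trans (mul_le_mul_of_nonneg_left hdist hκ)
    refine (measure_mono hsub).trans ((volume_rectangle_le _ _ _ _ _).trans ?_)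
    rw [iSup_pos hne, ENNReal.rpow_one, ← ENNReal.ofReal_toReal hfin, ← hd_def,
      ← ENNReal.ofReal_mul (by positivity), ← ENNReal.ofReal_mul (by positivity)]
    apply le_of_eq
    congr 1
    ring
  calc volume (segment ℝ 0 (r • unitVec α) + F)
      ≤ ∑' n, volume (segment ℝ 0 (r • unitVec α) + (F ∩ t n)) :=
        (measure_mono hcov).trans (measure_iUnion_le _)
    _ ≤ ∑' n, ENNReal.ofReal (8 * κ * |r|) *
          ⨆ _ : (t n).Nonempty, Metric.ediam (t n) ^ (1 : ℝ) := ENNReal.tsum_le_tsum hone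
    _ ≤ ENNReal.ofReal (8 * κ * |r|) * m := by
        rw [ENNReal.tsum_mul_left]
        exact mul_le_mul_right hsum.le _

lemma exists_polar (v : Plane) : ∃ r α : ℝ, 0 ≤ r ∧ v = r • unitVec α ∧ r = ‖v‖ ∧
    direction v = (α : DirectionSpace) := by
  have hn : ‖(⟨v 0, v 1⟩ : ℂ)‖ = ‖v‖ := by
    have h1 := norm_sq_plane v
    have h2 := Complex.sq_norm ⟨v 0, v 1⟩
    rw [Complex.normSq_mk] at h2
    have h3 : ‖(⟨v 0, v 1⟩ : ℂ)‖ ^ 2 = ‖v‖ ^ 2 := by rw [h1, h2]; ring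
    exact (sq_eq_sq₀ (norm_nonneg _) (norm_nonneg _)).1 h3
  refine ⟨‖v‖, Complex.arg ⟨v 0, v 1⟩, norm_nonneg _, ?_, rfl, rfl⟩
  ext i
  fin_cases i
  · have := Complex.norm_mul_cos_arg ⟨v 0, v 1⟩
    rw [hn] at this
    simpa using this.symm
  · have := Complex.norm_mul_sin_arg ⟨v 0, v 1⟩
    rw [hn] at this
    simpa using this.symm

/-! ### Labelled polygonal paths and the sets they sweep -/

/-- `LabelledPath p q T ℓ`: there is a polygonal path from `p` to `q` of length `ℓ`, each of whose
segments carries a direction; `T` is the set of its points paired with their labels. -/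
inductive LabelledPath : Plane → Plane → Set (Plane × DirectionSpace) → ℝ → Prop
  | single (p q : Plane) (φ : DirectionSpace) :
      LabelledPath p q (segment ℝ p q ×ˢ {φ}) (dist p q)
  | cons (p : Plane) {q r : Plane} (φ : DirectionSpace) {T : Set (Plane × DirectionSpace)} {ℓ : ℝ} :
      LabelledPath q r T ℓ → LabelledPath p r (segment ℝ p q ×ˢ {φ} ∪ T) (dist p q + ℓ)

/-- The union over `(p, φ) ∈ T` of the translate of `S φ` by `p`. -/
def sweep (T : Set (Plane × DirectionSpace)) (S : DirectionSpace → Set Plane) : Set Plane :=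
  ⋃ y ∈ T, (fun x => y.1 + x) '' S y.2

/-- The translate of a set of labelled points. -/
def shift (v : Plane) (T : Set (Plane × DirectionSpace)) : Set (Plane × DirectionSpace) :=
  (fun y => (v + y.1, y.2)) '' T

lemma mem_sweep {T : Set (Plane × DirectionSpace)} {S : DirectionSpace → Set Plane} {a : Plane} :
    a ∈ sweep T S ↔ ∃ p φ x, (p, φ) ∈ T ∧ x ∈ S φ ∧ p + x = a := by
  simp only [sweep, mem_iUnion, mem_image, exists_prop, Prod.exists]
  constructor
  · rintro ⟨p, φ, h, x, hx, rfl⟩; exact ⟨p, φ, x, h, hx, rfl⟩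
  · rintro ⟨p, φ, x, h, hx, rfl⟩; exact ⟨p, φ, h, x, hx, rfl⟩

lemma sweep_union (T T' : Set (Plane × DirectionSpace)) (S : DirectionSpace → Set Plane) :
    sweep (T ∪ T') S = sweep T S ∪ sweep T' S := biUnion_union _ _ _

lemma sweep_shift (v : Plane) (T : Set (Plane × DirectionSpace)) (S : DirectionSpace → Set Plane) :
    sweep (shift v T) S = (fun x => v + x) '' sweep T S := by
  ext a
  simp only [mem_sweep, mem_image, shift, Prod.exists, Prod.mk.injEq]
  constructor
  · rintro ⟨_, _, x, ⟨p, φ, h, rfl, rfl⟩, hx, rfl⟩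
    exact ⟨p + x, ⟨p, φ, x, h, hx, rfl⟩, by abel⟩
  · rintro ⟨_, ⟨p, φ, x, h, hx, rfl⟩, rfl⟩
    exact ⟨v + p, φ, x, ⟨p, φ, h, rfl, rfl⟩, hx, by abel⟩

lemma volume_sweep_shift (v : Plane) (T : Set (Plane × DirectionSpace))
    (S : DirectionSpace → Set Plane) : volume (sweep (shift v T) S) = volume (sweep T S) := by
  rw [sweep_shift, image_add_left, measure_preimage_add]

lemma volume_sweep_union_le (T T' : Set (Plane × DirectionSpace)) (S : DirectionSpace → Set Plane) :
    volume (sweep (T ∪ T') S) ≤ volume (sweep T S) + volume (sweep T' S) := by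
  rw [sweep_union]; exact measure_union_le _ _

lemma LabelledPath.trans {p q r : Plane} {T T' : Set (Plane × DirectionSpace)} {ℓ ℓ' : ℝ}
    (h : LabelledPath p q T ℓ) (h' : LabelledPath q r T' ℓ') :
    LabelledPath p r (T ∪ T') (ℓ + ℓ') := by
  induction h with
  | single p q φ => exact h'.cons p φ
  | cons p φ _ ih =>
    rw [union_assoc, add_assoc]
    exact (ih h').cons p φ

lemma LabelledPath.shift {p q : Plane} {T : Set (Plane × DirectionSpace)} {ℓ : ℝ}
    (h : LabelledPath p q T ℓ) (v : Plane) : LabelledPath (v + p) (v + q) (shift v T) ℓ := by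
  have hseg : ∀ (p q : Plane) (φ : DirectionSpace), _root_.shift v (segment ℝ p q ×ˢ {φ}) =
      segment ℝ (v + p) (v + q) ×ˢ {φ} := by
    intro p q φ
    rw [← segment_translate_image ℝ v p q]
    ext ⟨a, ψ⟩
    simp only [_root_.shift, mem_image, mem_prod, mem_singleton_iff, Prod.exists, Prod.mk.injEq]
    constructor
    · rintro ⟨b, _, ⟨hb, rfl⟩, rfl, rfl⟩; exact ⟨⟨b, hb, rfl⟩, rfl⟩
    · rintro ⟨⟨b, hb, rfl⟩, rfl⟩; exact ⟨b, _, ⟨hb, rfl⟩, rfl, rfl⟩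
  induction h with
  | single p q φ =>
    rw [hseg, ← dist_add_left v p q]
    exact .single _ _ _
  | @cons p q r φ T ℓ _ ih =>
    have : _root_.shift v (segment ℝ p q ×ˢ {φ} ∪ T) =
        _root_.shift v (segment ℝ p q ×ˢ {φ}) ∪ _root_.shift v T := image_union _ _ _
    rw [this, hseg, ← dist_add_left v p q]
    exact ih.cons _ _

/-- Concatenating `N` copies of a path. -/
lemma LabelledPath.repeat {w : Plane} {T : Set (Plane × DirectionSpace)} {ℓ : ℝ}
    (h : LabelledPath 0 w T ℓ) (N : ℕ) :
    ∃ T', LabelledPath 0 (((N + 1 : ℕ) : ℝ) • w) T' (((N + 1 : ℕ) : ℝ) * ℓ) ∧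
      (∀ S, volume (sweep T' S) ≤ ((N + 1 : ℕ) : ENNReal) * volume (sweep T S)) ∧
      ∀ y ∈ T', ∃ i ≤ N, ∃ y' ∈ T, y.1 = (i : ℝ) • w + y'.1 := by
  induction N with
  | zero =>
    refine ⟨T, by simpa using h, fun S => by simp, fun y hy => ⟨0, le_rfl, y, hy, by simp⟩⟩
  | succ N ih =>
    obtain ⟨T', h1, h2, h3⟩ := ih
    refine ⟨T' ∪ _root_.shift (((N + 1 : ℕ) : ℝ) • w) T, ?_, fun S => ?_, ?_⟩
    · have h4 := h.shift (((N + 1 : ℕ) : ℝ) • w)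
      rw [add_zero] at h4
      rw [Nat.cast_succ (N + 1), add_smul, one_smul, add_mul, one_mul]
      exact h1.trans h4
    · refine (volume_sweep_union_le _ _ _).trans ?_
      rw [volume_sweep_shift, Nat.cast_succ (N + 1), add_mul, one_mul]
      exact add_le_add (h2 S) le_rfl
    · rintro y (hy | ⟨y', hy', rfl⟩)
      · obtain ⟨i, hi, h⟩ := h3 y hy
        exact ⟨i, hi.trans (Nat.le_succ _), h⟩
      · exact ⟨N + 1, le_rfl, y', hy', rfl⟩

lemma LabelledPath.length_nonneg {p q : Plane} {T : Set (Plane × DirectionSpace)} {ℓ : ℝ}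
    (h : LabelledPath p q T ℓ) : 0 ≤ ℓ := by
  induction h with
  | single => positivity
  | cons _ _ _ ih => positivity

/-- A sweep along a segment of length `r` contains `F`, and its area is `O(r)`; let `r` tend to `0`.
-/
lemma volume_eq_zero_of_hausdorffMeasure_one_lt_top {F : Set Plane}
    (hF : Measure.hausdorffMeasure 1 F < ⊤) : volume F = 0 := by
  obtain ⟨m, hm, hm'⟩ := exists_between hF
  have h : ∀ r : ℝ, 0 < r → volume F ≤ ENNReal.ofReal (8 * 1 * |r|) * m := by
    intro r hr
    refine (measure_mono fun x hx => ?_).trans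
      (volume_segment_add_le zero_le_one hr.ne' (coneCondition_one 0 F) hm)
    exact ⟨0, left_mem_segment ℝ _ _, x, hx, zero_add x⟩
  have hlim : Filter.Tendsto (fun r : ℝ => ENNReal.ofReal (8 * 1 * |r|) * m)
      (nhdsWithin 0 (Ioi 0)) (nhds 0) := by
    have h1 : Filter.Tendsto (fun r : ℝ => ENNReal.ofReal (8 * 1 * |r|)) (nhds 0) (nhds 0) := by
      have : Continuous fun r : ℝ => ENNReal.ofReal (8 * 1 * |r|) :=
        ENNReal.continuous_ofReal.comp (by fun_prop)
      simpa using this.tendsto 0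
    simpa using ENNReal.Tendsto.mul_const (h1.mono_left nhdsWithin_le_nhds) (Or.inr hm'.ne)
  exact le_antisymm (ge_of_tendsto hlim (by filter_upwards [self_mem_nhdsWithin] with r hr
                                            using h r hr)) zero_le

lemma volume_sweep_segment_le (p q : Plane) (φ : DirectionSpace) {F : Set Plane} {m : ENNReal}
    (hm : Measure.hausdorffMeasure 1 F < m) :
    volume (sweep (segment ℝ p q ×ˢ {φ}) fun _ => F) ≤ ENNReal.ofReal (8 * dist p q) * m := by
  have hsub : sweep (segment ℝ p q ×ˢ {φ}) (fun _ => F) ⊆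
      (fun x => p + x) '' (segment ℝ 0 (q - p) + F) := by
    intro a ha
    obtain ⟨b, _, x, ⟨hb, _⟩, hx, rfl⟩ := mem_sweep.1 ha
    have hb' : b ∈ segment ℝ (p + 0) (p + (q - p)) := by simpa using hb
    rw [← segment_translate_image] at hb'
    obtain ⟨b', hb', rfl⟩ := hb'
    exact ⟨b' + x, ⟨b', hb', x, hx, rfl⟩, by simp only; abel⟩
  refine (measure_mono hsub).trans ?_
  rw [image_add_left, measure_preimage_add]
  obtain ⟨r, α, hr, hv, hrn, -⟩ := exists_polar (q - p)
  have hd : dist p q = r := by rw [hrn, dist_comm, dist_eq_norm]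
  rcases eq_or_ne r 0 with h0 | h0
  · rw [hv, h0, zero_smul, segment_same, singleton_add, hd, h0]
    simp [volume_eq_zero_of_hausdorffMeasure_one_lt_top (hm.trans_le le_top)]
  · have := volume_segment_add_le zero_le_one h0 (coneCondition_one α F) hm
    rwa [mul_one, abs_of_nonneg hr, ← hv, ← hd] at this

/-- The area swept by any set is controlled by its length and the length of the path. -/
lemma LabelledPath.volume_sweep_le {p q : Plane} {T : Set (Plane × DirectionSpace)} {ℓ : ℝ}
    (h : LabelledPath p q T ℓ) {F : Set Plane} {m : ENNReal}
    (hm : Measure.hausdorffMeasure 1 F < m) :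
    volume (sweep T fun _ => F) ≤ ENNReal.ofReal (8 * ℓ) * m := by
  induction h with
  | single p q φ => exact volume_sweep_segment_le p q φ hm
  | cons p φ h ih =>
    refine (volume_sweep_union_le _ _ _).trans ?_
    rw [mul_add, ENNReal.ofReal_add (by positivity) (mul_nonneg (by norm_num) h.length_nonneg),
      add_mul]
    exact add_le_add (volume_sweep_segment_le _ _ φ hm) ih

/-- Every labelled path is an indexed family of consecutive segments. -/
lemma LabelledPath.exists_fin {p r : Plane} {T : Set (Plane × DirectionSpace)} {ℓ : ℝ}
    (h : LabelledPath p r T ℓ) :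
    ∃ (n : ℕ) (q : Fin (n + 1) → Plane) (φ : Fin n → DirectionSpace),
      0 < n ∧ q 0 = p ∧ q (Fin.last n) = r ∧
      ∀ i, segment ℝ (q i.castSucc) (q i.succ) ×ˢ {φ i} ⊆ T := by
  induction h with
  | single p q φ =>
    refine ⟨1, ![p, q], ![φ], one_pos, rfl, rfl, fun i => ?_⟩
    fin_cases i
    exact subset_rfl
  | @cons p q r φ T ℓ _ ih =>
    obtain ⟨n, q', φ', hn, h0, hl, hT⟩ := ih
    refine ⟨n + 1, Fin.cons p q', Fin.cons φ φ', Nat.succ_pos _, rfl, ?_, fun i => ?_⟩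
    · rw [← Fin.succ_last, Fin.cons_succ, hl]
    · refine Fin.cases ?_ (fun i => ?_) i
      · simp only [Fin.castSucc_zero, Fin.cons_zero, Fin.cons_succ, h0]
        exact subset_union_left
      · rw [← Fin.succ_castSucc]
        simp only [Fin.cons_succ]
        exact (hT i).trans subset_union_right

lemma norm_le_of_mem_segment_zero {w p : Plane} (hp : p ∈ segment ℝ 0 w) : ‖p‖ ≤ ‖w‖ := by
  rw [segment_eq_image] at hp
  obtain ⟨s, ⟨hs0, hs1⟩, rfl⟩ := hp
  simp only [smul_zero, zero_add]
  rw [norm_smul, Real.norm_of_nonneg hs0]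
  exact mul_le_of_le_one_left (norm_nonneg _) hs1

/-! ### Stability of the swept area near a segment -/

/-- A path staying close to a segment in direction `α` sweeps only slightly more area than the
segment does. -/
lemma exists_pos_volume_sweep_le {κ α r : ℝ} (hκ : 0 < κ) (hr : r ≠ 0) {K : Set Plane}
    (hK : IsCompact K) (hcone : ConeCondition κ α K) {m : ENNReal}
    (hm : Measure.hausdorffMeasure 1 K < m) :
    ∃ η : ℝ, 0 < η ∧ ∀ (T : Set (Plane × DirectionSpace)) (S : DirectionSpace → Set Plane),
      (∀ y ∈ T, ∃ p ∈ segment ℝ 0 (r • unitVec α), dist y.1 p ≤ η) → (∀ φ, S φ ⊆ K) →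
      volume (sweep T S) ≤ ENNReal.ofReal (8 * κ * |r|) * m := by
  obtain ⟨m', hm1, hm2⟩ := exists_between hm
  have hc : 0 < ENNReal.ofReal (8 * κ * |r|) :=
    ENNReal.ofReal_pos.2 (by have := abs_pos.2 hr; positivity)
  have hlt : volume (segment ℝ 0 (r • unitVec α) + K) < ENNReal.ofReal (8 * κ * |r|) * m :=
    (volume_segment_add_le hκ.le hr hcone hm1).trans_lt
      ((ENNReal.mul_lt_mul_iff_right hc.ne' ENNReal.ofReal_ne_top).2 hm2)
  have hcomp : IsCompact (segment ℝ 0 (r • unitVec α) + K) := by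
    refine IsCompact.add ?_ hK
    rw [segment_eq_image]
    exact isCompact_Icc.image (by fun_prop)
  -- The closed thickenings of the compact set segment plus `K` have measures converging to its own,
  -- and the slack between `m'` and `m` absorbs the excess for a small radius.
  have hev := (tendsto_measure_cthickening_of_isCompact (μ := volume) hcomp).eventually
    (gt_mem_nhds hlt)
  obtain ⟨ρ, hρ, hball⟩ := Metric.eventually_nhds_iff.1 hev
  refine ⟨ρ / 2, by positivity, fun T S hT hS => ?_⟩
  have h2 := hball (y := ρ / 2) (by rw [Real.dist_0_eq_abs, abs_of_pos] <;> linarith)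
  refine (measure_mono ?_).trans h2.le
  intro a ha
  obtain ⟨b, φ, x, hb, hx, rfl⟩ := mem_sweep.1 ha
  obtain ⟨p, hp, hd⟩ := hT _ hb
  exact Metric.mem_cthickening_of_dist_le _ (p + x) _ _ ⟨p, hp, x, hS φ hx, rfl⟩
    (by simpa using hd)

/-- The path is built after its tolerance is fixed, so one `η` must serve all pieces: take the
minimum over the finite family. -/
lemma exists_pos_forall_volume_sweep_le {ι : Type*} [Finite ι] {κ α r : ℝ} (hκ : 0 < κ)
    (hr : r ≠ 0) {K : ι → Set Plane} (hK : ∀ i, IsCompact (K i)) {m : ι → ENNReal}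
    (hm : ∀ i, Measure.hausdorffMeasure 1 (K i) < m i) :
    ∃ η : ℝ, 0 < η ∧ ∀ i, ConeCondition κ α (K i) →
      ∀ (T : Set (Plane × DirectionSpace)) (S : DirectionSpace → Set Plane),
      (∀ y ∈ T, ∃ p ∈ segment ℝ 0 (r • unitVec α), dist y.1 p ≤ η) → (∀ φ, S φ ⊆ K i) →
      volume (sweep T S) ≤ ENNReal.ofReal (8 * κ * |r|) * m i := by
  have h : ∀ i, ∃ η : ℝ, 0 < η ∧ (ConeCondition κ α (K i) →
      ∀ (T : Set (Plane × DirectionSpace)) (S : DirectionSpace → Set Plane),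
      (∀ y ∈ T, ∃ p ∈ segment ℝ 0 (r • unitVec α), dist y.1 p ≤ η) → (∀ φ, S φ ⊆ K i) →
      volume (sweep T S) ≤ ENNReal.ofReal (8 * κ * |r|) * m i) := by
    intro i
    by_cases hc : ConeCondition κ α (K i)
    · obtain ⟨η, hη, h⟩ := exists_pos_volume_sweep_le hκ hr (hK i) hc (hm i)
      exact ⟨η, hη, fun _ => h⟩
    · exact ⟨1, one_pos, fun h => absurd h hc⟩
  choose η hη h using h
  rcases isEmpty_or_nonempty ι with hι | hι
  · exact ⟨1, one_pos, fun i => isEmptyElim i⟩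
  · obtain ⟨i₀, hi₀⟩ := Finite.exists_min η
    refine ⟨η i₀, hη i₀, fun i hc T S hT hS => h i hc T S (fun y hy => ?_) hS⟩
    obtain ⟨p, hp, hd⟩ := hT y hy
    exact ⟨p, hp, hd.trans (hi₀ i)⟩

/-! ### The recursive zigzag -/

lemma sin_le_sin_of_mem_Icc {a x : ℝ} (ha : 0 ≤ a) (hax : a ≤ x) (hx : x ≤ Real.pi - a) :
    Real.sin a ≤ Real.sin x := by
  have h := Real.sin_sub_sin x a
  have h1 : 0 ≤ Real.sin ((x - a) / 2) :=
    Real.sin_nonneg_of_nonneg_of_le_pi (by linarith) (by linarith)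
  have h2 : 0 ≤ Real.cos ((x + a) / 2) :=
    Real.cos_nonneg_of_neg_pi_div_two_le_of_le (by linarith) (by linarith)
  have := mul_nonneg h1 h2
  nlinarith

/-- Splitting a vector along two directions on the same side of it. -/
lemma unitVec_split {τ : ℝ} (hτ : τ = 1 ∨ τ = -1) (α : ℝ) {x δ : ℝ} (hx : Real.sin x ≠ 0) :
    unitVec α = (Real.sin (x + δ) / Real.sin x) • unitVec (α + τ * δ) +
      (-(Real.sin δ / Real.sin x)) • unitVec (α + τ * (x + δ)) := by
  have h := Real.sin_sq_add_cos_sq δ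
  ext i
  rcases hτ with rfl | rfl <;> fin_cases i <;>
    simp only [Fin.zero_eta, Fin.mk_one, PiLp.add_apply, PiLp.smul_apply, unitVec_zero_apply,
      unitVec_one_apply, smul_eq_mul, one_mul, neg_mul, ← sub_eq_add_neg, Real.sin_add,
      Real.cos_add, Real.sin_sub, Real.cos_sub] <;>
    field_simp
  · linear_combination -(Real.cos α * Real.sin x) * h
  · linear_combination -(Real.sin α * Real.sin x) * h
  · linear_combination -(Real.cos α * Real.sin x) * h
  · linear_combination -(Real.sin α * Real.sin x) * h

/-- Keeping `x` and `x + δ` between `ε₁` and `π - ε₁` bounds `sin x` below by `sin ε₁`, so the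
zigzag is longer than the segment only by a relative `O(δ)`. -/
lemma split_length_le {ε₁ x δ : ℝ} (hε₁ : 0 < ε₁) (hx : ε₁ ≤ x) (hδ : 0 < δ)
    (hxδ : x + δ ≤ Real.pi - ε₁) :
    |Real.sin (x + δ) / Real.sin x| + |(-(Real.sin δ / Real.sin x))| ≤
      1 + 2 * δ / Real.sin ε₁ := by
  have h1 : 0 < Real.sin ε₁ := Real.sin_pos_of_pos_of_lt_pi hε₁ (by linarith)
  have h2 : Real.sin ε₁ ≤ Real.sin x := sin_le_sin_of_mem_Icc hε₁.le hx (by linarith)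
  have h3 : 0 < Real.sin (x + δ) := Real.sin_pos_of_pos_of_lt_pi (by linarith) (by linarith)
  have h4 : 0 < Real.sin δ := Real.sin_pos_of_pos_of_lt_pi hδ (by linarith)
  have h5 : Real.sin δ ≤ δ := Real.sin_le hδ.le
  have hxp := h1.trans_le h2
  have h6 : Real.sin (x + δ) ≤ Real.sin x + δ := by
    rw [Real.sin_add]
    nlinarith [Real.cos_le_one x, Real.cos_le_one δ]
  rw [abs_neg, abs_of_pos (by positivity), abs_of_pos (by positivity), ← add_div]
  calc (Real.sin (x + δ) + Real.sin δ) / Real.sin x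
      ≤ (Real.sin x + 2 * δ) / Real.sin x :=
        div_le_div_of_nonneg_right (by linarith) hxp.le
    _ = 1 + 2 * δ / Real.sin x := by field_simp
    _ ≤ _ := by gcongr

/-- The part of `K` that remains when the label is `φ`, if `K` has direction `u` and directions at
distance less than `ρ` from the label are deleted. -/
def remaining (ρ : ℝ) (K : Set Plane) (u φ : DirectionSpace) : Set Plane :=
  {x ∈ K | u ∉ Metric.ball φ ρ}

/-- Induction on the opening of the controlled sector, `δ` at a time. The sign `τ` is needed because
the two legs see their common sector from opposite ends, and `r` may be negative because the second
leg runs backwards. Closeness `η` to the segment is part of the conclusion so that the next stage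
can exploit it. -/
lemma exists_path_of_directions {ι : Type*} [Finite ι] {K : ι → Set Plane} {u : ι → DirectionSpace}
    {m : ι → ENNReal} {δ ε₁ ρ G : ℝ} (hK : ∀ i, IsCompact (K i))
    (hcone : ∀ i (β : ℝ), (β : DirectionSpace) = u i → ConeCondition δ β (K i))
    (hm : ∀ i, Measure.hausdorffMeasure 1 (K i) < m i)
    (hδ : 0 < δ) (hε₁ : 0 < ε₁) (hρ : ε₁ < ρ) (hG : 1 + 2 * δ / Real.sin ε₁ ≤ G) (k : ℕ) :
    ∀ (α τ r : ℝ), r ≠ 0 → (τ = 1 ∨ τ = -1) → ε₁ + k * δ ≤ Real.pi - ε₁ → ∀ η : ℝ, 0 < η →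
    ∃ T ℓ, LabelledPath 0 (r • unitVec α) T ℓ ∧ ℓ ≤ |r| * G ^ k ∧
      (∀ y ∈ T, ∃ p ∈ segment ℝ 0 (r • unitVec α), dist y.1 p ≤ η) ∧
      ∀ i, (∃ t ∈ Icc 0 (ε₁ + k * δ), u i = ((α + τ * t : ℝ) : DirectionSpace)) →
        volume (sweep T (remaining ρ (K i) (u i))) ≤
          ENNReal.ofReal (|r| * (16 * δ * G ^ k)) * m i := by
  induction k with
  | zero =>
    intro α τ r hr hτ hx η hη
    refine ⟨_, _, .single 0 (r • unitVec α) (α : DirectionSpace), ?_, ?_, ?_⟩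
    · rw [dist_zero_left, norm_smul_unitVec]; simp
    · rintro ⟨p, φ⟩ ⟨hp, -⟩
      exact ⟨p, hp, by simpa using hη.le⟩
    · rintro i ⟨t, ⟨ht0, ht1⟩, hu⟩
      -- Here `t ≤ ε₁ < ρ`, so the label deletes the whole piece.
      have hempty : sweep (segment ℝ 0 (r • unitVec α) ×ˢ {(α : DirectionSpace)})
          (remaining ρ (K i) (u i)) = ∅ := by
        rw [eq_empty_iff_forall_notMem]
        intro a ha
        obtain ⟨p, φ, x, ⟨_, hφ⟩, ⟨_, hx⟩, rfl⟩ := mem_sweep.1 ha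
        rw [mem_singleton_iff] at hφ
        subst hφ
        apply hx
        rw [Metric.mem_ball, hu, AddCircle.coe_add, dist_eq_norm, add_sub_cancel_left]
        have h1 : ‖((τ * t : ℝ) : DirectionSpace)‖ ≤ ‖τ * t‖ :=
          QuotientAddGroup.norm_mk_le_norm
        have h2 : ‖τ * t‖ = t := by
          rcases hτ with rfl | rfl <;> simp [abs_of_nonneg ht0]
        simp only [Nat.cast_zero, zero_mul, add_zero] at ht1
        linarith
      rw [hempty, measure_empty]
      exact zero_le
  | succ k ih =>
    intro α τ r hr hτ hx η hη
    set x : ℝ := ε₁ + k * δ with hxdef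
    have hxs : ε₁ + (k + 1 : ℕ) * δ = x + δ := by push_cast; ring
    rw [hxs] at hx ⊢
    have hxε : ε₁ ≤ x := by simp only [hxdef]; have := hδ.le; nlinarith [k.cast_nonneg (α := ℝ)]
    have hsx : 0 < Real.sin x := Real.sin_pos_of_pos_of_lt_pi (by linarith) (by linarith)
    have hsxδ : 0 < Real.sin (x + δ) := Real.sin_pos_of_pos_of_lt_pi (by linarith) (by linarith)
    have hsδ : 0 < Real.sin δ := Real.sin_pos_of_pos_of_lt_pi hδ (by linarith)
    set A := Real.sin (x + δ) / Real.sin x with hA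
    set B := -(Real.sin δ / Real.sin x) with hB
    have hA0 : A ≠ 0 := (div_pos hsxδ hsx).ne'
    have hB0 : B ≠ 0 := neg_ne_zero.2 (div_pos hsδ hsx).ne'
    have hABG : |A| + |B| ≤ G := (split_length_le hε₁ hxε hδ hx).trans hG
    have hsε : 0 < Real.sin ε₁ := Real.sin_pos_of_pos_of_lt_pi hε₁ (by linarith)
    have hG1 : 1 ≤ G := le_trans (by have := div_pos (mul_pos two_pos hδ) hsε; linarith) hG
    have hsplit := unitVec_split hτ α (δ := δ) hsx.ne'
    rw [← hA, ← hB] at hsplit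
    -- The tolerance is `2 * δ`: one `δ` from the cone condition of a piece, one from the angle
    -- between its direction and `α`.
    obtain ⟨η₁, hη₁, hcut⟩ := exists_pos_forall_volume_sweep_le (κ := 2 * δ) (α := α) (by positivity)
      hr hK hm
    set η₀ := min η η₁ with hη₀
    have hη₀' : 0 < η₀ := lt_min hη hη₁
    -- With `N + 1` zigzags, each has total leg length at most `η₀ / 2`; the subpaths deviate from
    -- their legs by at most another `η₀ / 2`.
    obtain ⟨N, hN⟩ := exists_nat_gt ((|r * A| + |r * B|) / (η₀ / 2))
    set c : ℝ := ((N + 1 : ℕ) : ℝ) with hc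
    have hcpos : 0 < c := by positivity
    have hsmall : (|r * A| + |r * B|) / c ≤ η₀ / 2 := by
      rw [div_lt_iff₀ (by positivity)] at hN
      rw [div_le_iff₀ hcpos, hc]
      push_cast
      nlinarith
    have hτ' : -τ = 1 ∨ -τ = -1 := by rcases hτ with rfl | rfl <;> simp
    obtain ⟨T₁, ℓ₁, hP₁, hℓ₁, hn₁, hv₁⟩ := ih (α + τ * δ) τ (r * A / c)
      (div_ne_zero (mul_ne_zero hr hA0) hcpos.ne') hτ (by linarith) (η₀ / 2) (by positivity)
    obtain ⟨T₂, ℓ₂, hP₂, hℓ₂, hn₂, hv₂⟩ := ih (α + τ * (x + δ)) (-τ) (r * B / c)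
      (div_ne_zero (mul_ne_zero hr hB0) hcpos.ne') hτ' (by linarith) (η₀ / 2) (by positivity)
    set v₁ := (r * A / c) • unitVec (α + τ * δ) with hv₁def
    set v₂ := (r * B / c) • unitVec (α + τ * (x + δ)) with hv₂def
    have hP₂' := hP₂.shift v₁
    rw [add_zero] at hP₂'
    obtain ⟨T, hP, hvol, hnear⟩ := (hP₁.trans hP₂').repeat N
    have hw : ((N + 1 : ℕ) : ℝ) • (v₁ + v₂) = r • unitVec α := by
      rw [← hc, hv₁def, hv₂def, smul_add, smul_smul, smul_smul, mul_div_cancel₀ _ hcpos.ne',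
        mul_div_cancel₀ _ hcpos.ne', mul_smul, mul_smul, ← smul_add, ← hsplit]
    rw [hw] at hP
    have hnv₁ : ‖v₁‖ = |r * A| / c := by rw [norm_smul_unitVec, abs_div, abs_of_pos hcpos]
    have hnv₂ : ‖v₂‖ = |r * B| / c := by rw [norm_smul_unitVec, abs_div, abs_of_pos hcpos]
    have hclose : ∀ y ∈ T, ∃ p ∈ segment ℝ 0 (r • unitVec α), dist y.1 p ≤ η₀ := by
      intro y hy
      obtain ⟨i, hi, y', hy', hyy⟩ := hnear y hy
      refine ⟨(i : ℝ) • (v₁ + v₂), ?_, ?_⟩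
      · rw [segment_eq_image]
        refine ⟨i / c, ⟨by positivity, ?_⟩, ?_⟩
        · rw [div_le_one hcpos, hc]; exact_mod_cast hi.trans (Nat.le_succ N)
        · simp only [smul_zero, zero_add]
          rw [← hw, ← hc, smul_smul, div_mul_cancel₀ _ hcpos.ne']
      · rw [hyy, dist_self_add_left]
        rw [add_div, ← hnv₁, ← hnv₂] at hsmall
        rcases hy' with hy' | ⟨y₂, hy₂, rfl⟩
        · obtain ⟨p, hp, hd⟩ := hn₁ y' hy'
          have h1 := norm_le_of_mem_segment_zero hp
          have h2 : ‖y'.1‖ ≤ ‖p‖ + dist y'.1 p := by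
            rw [dist_eq_norm]; exact norm_le_norm_add_norm_sub' _ _
          linarith [norm_nonneg v₂]
        · obtain ⟨p, hp, hd⟩ := hn₂ y₂ hy₂
          have h1 := norm_le_of_mem_segment_zero hp
          have h2 : ‖y₂.1‖ ≤ ‖p‖ + dist y₂.1 p := by
            rw [dist_eq_norm]; exact norm_le_norm_add_norm_sub' _ _
          have h3 := norm_add_le v₁ y₂.1
          simp only
          linarith
    have hsum : c * (|r * A / c| + |r * B / c|) ≤ |r| * G := by
      rw [abs_div, abs_div, abs_of_pos hcpos, ← add_div, mul_div_cancel₀ _ hcpos.ne', abs_mul,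
        abs_mul, ← mul_add]
      exact mul_le_mul_of_nonneg_left hABG (abs_nonneg _)
    have hGk : 0 < G ^ k := by positivity
    refine ⟨T, _, hP, ?_, fun y hy => ?_, ?_⟩
    · rw [← hc]
      calc c * (ℓ₁ + ℓ₂) ≤ c * (|r * A / c| * G ^ k + |r * B / c| * G ^ k) := by gcongr
        _ = c * (|r * A / c| + |r * B / c|) * G ^ k := by ring
        _ ≤ |r| * G * G ^ k := by gcongr
        _ = _ := by ring
    · obtain ⟨p, hp, hd⟩ := hclose y hy
      exact ⟨p, hp, hd.trans (min_le_left _ _)⟩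
    · rintro i ⟨t, ⟨ht0, ht1⟩, hu⟩
      -- Directions within `δ` of `α` are paid for by closeness to the segment; the others lie in
      -- the sector common to both legs, at angle `t - δ` from the first and `x + δ - t` from the
      -- second.
      rcases le_total t δ with htδ | htδ
      · have hcone' : ConeCondition (2 * δ) α (K i) := by
          refine (hcone i _ hu.symm).rotate ?_
          have : |α - (α + τ * t)| = t := by
            rcases hτ with rfl | rfl <;> simp [abs_of_nonneg ht0]
          linarith
        refine (hcut i hcone' T _ (fun y hy => ?_) (fun φ x hx => hx.1)).trans ?_
        · obtain ⟨p, hp, hd⟩ := hclose y hy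
          exact ⟨p, hp, hd.trans (min_le_right _ _)⟩
        · refine mul_le_mul_left (ENNReal.ofReal_le_ofReal ?_) _
          have : 1 ≤ G ^ (k + 1) := one_le_pow₀ hG1
          have h3 : 0 ≤ |r| * (16 * δ) := by positivity
          nlinarith
      · have h1 := hv₁ i ⟨t - δ, ⟨by linarith, by linarith⟩, by rw [hu]; congr 1; ring⟩
        have h2 := hv₂ i ⟨x + δ - t, ⟨by linarith, by linarith⟩, by rw [hu]; congr 1; ring⟩
        refine (hvol _).trans ?_
        have hcE : ((N + 1 : ℕ) : ENNReal) = ENNReal.ofReal c := by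
          rw [hc, ENNReal.ofReal_natCast]
        calc ((N + 1 : ℕ) : ENNReal) * volume (sweep (T₁ ∪ shift v₁ T₂) (remaining ρ (K i) (u i)))
            ≤ ((N + 1 : ℕ) : ENNReal) *
                (ENNReal.ofReal (|r * A / c| * (16 * δ * G ^ k)) * m i +
                  ENNReal.ofReal (|r * B / c| * (16 * δ * G ^ k)) * m i) := by
              gcongr
              refine (volume_sweep_union_le _ _ _).trans ?_
              rw [volume_sweep_shift]
              exact add_le_add h1 h2
          _ = ENNReal.ofReal (c * (|r * A / c| + |r * B / c|) * (16 * δ * G ^ k)) * m i := by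
              rw [← add_mul, ← ENNReal.ofReal_add (by positivity) (by positivity), ← mul_assoc,
                hcE, ← ENNReal.ofReal_mul hcpos.le]
              congr 2
              ring
          _ ≤ ENNReal.ofReal (|r| * (16 * δ * G ^ (k + 1))) * m i := by
              refine mul_le_mul_left (ENNReal.ofReal_le_ofReal ?_) _
              calc c * (|r * A / c| + |r * B / c|) * (16 * δ * G ^ k)
                  ≤ |r| * G * (16 * δ * G ^ k) := by gcongr
                _ = _ := by ring

/-! ### Decomposition of a rectifiable set into short arcs -/

/-- The jump of `arg` across the negative axis is `2π`, hence disappears modulo `2π` and a fortiori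
modulo `π`. -/
lemma continuousAt_direction {v : Plane} (hv : v ≠ 0) : ContinuousAt direction v := by
  let f : Real.Angle → DirectionSpace :=
    QuotientAddGroup.map (AddSubgroup.zmultiples (2 * Real.pi)) (AddSubgroup.zmultiples Real.pi)
      (AddMonoidHom.id ℝ) (by
        rw [AddSubgroup.zmultiples_le]
        exact ⟨2, by simp⟩)
  have hf : Continuous f := by
    refine continuous_quot_lift _ ?_
    exact continuous_quotient_mk'
  have hc : ContinuousAt (fun w : Plane => (⟨w 0, w 1⟩ : ℂ)) v := by
    have : Continuous fun w : Plane => (⟨w 0, w 1⟩ : ℂ) := by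
      have h : (fun w : Plane => (⟨w 0, w 1⟩ : ℂ)) = fun w => (w 0 : ℂ) + (w 1 : ℂ) * Complex.I := by
        funext w; apply Complex.ext <;> simp
      rw [h]; fun_prop
    exact this.continuousAt
  have hne : (⟨v 0, v 1⟩ : ℂ) ≠ 0 := by
    intro h
    apply hv
    ext i
    fin_cases i
    · exact congrArg Complex.re h
    · exact congrArg Complex.im h
  have h1 := (Complex.continuousAt_arg_coe_angle hne).comp_of_eq hc rfl
  exact hf.continuousAt.comp h1

lemma IsC1Curve.exists_short_arc {γ : ℝ → Plane} (hγ : IsC1Curve γ) (t₀ : ℝ) {δ : ℝ} (hδ : 0 < δ) :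
    ∃ r > 0, (∀ β : ℝ, (β : DirectionSpace) = direction (deriv γ t₀) →
        ConeCondition δ β (γ '' Metric.closedBall t₀ r)) ∧
      ∀ t ∈ Metric.closedBall t₀ r, dist (direction (deriv γ t)) (direction (deriv γ t₀)) < δ := by
  obtain ⟨hdiff, hne⟩ := hγ
  have hcont : Continuous (deriv γ) := hdiff.continuous_deriv le_rfl
  have hn : 0 < ‖deriv γ t₀‖ := norm_pos_iff.2 (hne t₀)
  have hδ' : 0 < min δ 1 := lt_min hδ one_pos
  set c : ℝ := min δ 1 * ‖deriv γ t₀‖ / 2 with hc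
  have hcpos : 0 < c := by positivity
  -- Strict differentiability bounds the linearization error by `c * |t - t'|` uniformly near `t₀`.
  -- The factor `min δ 1 / 2` in `c` also keeps each chord at least half its linear prediction, so
  -- error over chord is at most `δ`.
  have hstrict := (hdiff.contDiffAt (x := t₀)).hasStrictDerivAt one_ne_zero
  obtain ⟨s, hs, happ⟩ := hstrict.hasStrictFDerivAt.approximates_deriv_on_nhds
    (c := ⟨c, hcpos.le⟩) (Or.inr hcpos)
  have hdir : ∀ᶠ t in nhds t₀, dist (direction (deriv γ t)) (direction (deriv γ t₀)) < δ :=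
    ((continuousAt_direction (hne t₀)).comp_of_eq hcont.continuousAt rfl).eventually
      (Metric.ball_mem_nhds _ hδ)
  obtain ⟨r, hr, hball⟩ := Metric.nhds_basis_closedBall.mem_iff.1 (Filter.inter_mem hs hdir)
  refine ⟨r, hr, fun β hβ => ?_, fun t ht => (hball ht).2⟩
  obtain ⟨ρ, α, hρ, hv, hρn, hα⟩ := exists_polar (deriv γ t₀)
  refine ConeCondition.congr (α := α) ?_ (hα.symm.trans hβ.symm)
  rintro _ ⟨t, ht, rfl⟩ _ ⟨t', ht', rfl⟩
  have h1 := happ t (hball ht).1 t' (hball ht').1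
  simp only [ContinuousLinearMap.toSpanSingleton_apply, Real.norm_eq_abs] at h1
  change _ ≤ c * |t - t'| at h1
  set e := γ t - γ t' - (t - t') • deriv γ t₀ with he
  have h2 : γ t - γ t' = e + (t - t') • deriv γ t₀ := by rw [he]; abel
  have h3 : cross (γ t - γ t') (unitVec α) = cross e (unitVec α) := by
    rw [h2, hv]
    simp only [cross, PiLp.add_apply, PiLp.smul_apply, unitVec_zero_apply, unitVec_one_apply,
      smul_eq_mul]
    ring
  have h4 : |cross e (unitVec α)| ≤ ‖e‖ := by
    simpa [norm_unitVec] using abs_cross_le e (unitVec α)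
  have h5 : |t - t'| * ‖deriv γ t₀‖ - ‖e‖ ≤ ‖γ t - γ t'‖ := by
    rw [h2, ← Real.norm_eq_abs, ← norm_smul]
    have := norm_sub_le (e + (t - t') • deriv γ t₀) e
    rw [add_sub_cancel_left] at this
    linarith
  have h6 : min δ 1 ≤ δ := min_le_left _ _
  have h7 : min δ 1 ≤ 1 := min_le_right _ _
  have hm := abs_nonneg (t - t')
  have h8 : |t - t'| * ‖deriv γ t₀‖ ≤ 2 * ‖γ t - γ t'‖ := by
    have : c * |t - t'| ≤ |t - t'| * ‖deriv γ t₀‖ / 2 := by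
      rw [hc]; nlinarith [mul_nonneg hm hn.le]
    linarith
  rw [h3]
  calc |cross e (unitVec α)| ≤ c * |t - t'| := h4.trans h1
    _ = min δ 1 * (|t - t'| * ‖deriv γ t₀‖) / 2 := by rw [hc]; ring
    _ ≤ min δ 1 * (2 * ‖γ t - γ t'‖) / 2 := by gcongr
    _ ≤ δ * ‖γ t - γ t'‖ := by nlinarith [norm_nonneg (γ t - γ t')]

/-- Countably many `C¹` curves are covered by countably many short arcs. -/
lemma exists_short_arcs {Γ : ℕ → ℝ → Plane} (hΓ : ∀ i, IsC1Curve (Γ i)) {δ : ℝ} (hδ : 0 < δ) :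
    ∃ (A : ℕ → Set Plane) (u : ℕ → DirectionSpace), (∀ n, IsCompact (A n)) ∧
      (∀ n (β : ℝ), (β : DirectionSpace) = u n → ConeCondition δ β (A n)) ∧
      (∀ n, ∃ γ, IsC1Curve γ ∧ ∀ x ∈ A n, ∃ t, γ t = x ∧
        dist (direction (deriv γ t)) (u n) < δ) ∧
      ⋃ i, range (Γ i) ⊆ ⋃ n, A n := by
  choose r hr hcone hdir using fun i t => (hΓ i).exists_short_arc t hδ
  have hcov : ∀ i, ∃ f : ℕ → ℝ, ⋃ j, Metric.closedBall (f j) (r i (f j)) = univ := by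
    intro i
    obtain ⟨s, hs, hs'⟩ := TopologicalSpace.countable_cover_nhds
      (f := fun t => Metric.closedBall t (r i t)) fun t => Metric.closedBall_mem_nhds t (hr i t)
    have hne : s.Nonempty := by
      obtain ⟨t, ht, -⟩ := mem_iUnion₂.1 (hs' ▸ mem_univ (0 : ℝ))
      exact ⟨t, ht⟩
    obtain ⟨f, rfl⟩ := hs.exists_eq_range hne
    exact ⟨f, by rw [← hs', biUnion_range]⟩
  choose f hf using hcov
  refine ⟨fun n => Γ n.unpair.1 ''
      Metric.closedBall (f n.unpair.1 n.unpair.2) (r n.unpair.1 (f n.unpair.1 n.unpair.2)),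
    fun n => direction (deriv (Γ n.unpair.1) (f n.unpair.1 n.unpair.2)), fun n => ?_,
    fun n => hcone _ _, fun n => ⟨Γ n.unpair.1, hΓ _, ?_⟩, ?_⟩
  · exact (isCompact_closedBall _ _).image (hΓ _).1.continuous
  · rintro _ ⟨t, ht, rfl⟩
    exact ⟨t, rfl, hdir _ _ t ht⟩
  · rintro x hx
    obtain ⟨i, t, rfl⟩ := mem_iUnion.1 hx
    obtain ⟨j, hj⟩ := mem_iUnion.1 (hf i ▸ mem_univ t)
    refine mem_iUnion.2 ⟨Nat.pair i j, ?_⟩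
    simp only [Nat.unpair_pair]
    exact ⟨t, hj, rfl⟩

/-- Up to a set of small length, a rectifiable set lies in finitely many disjoint compact pieces of
short arcs. -/
lemma exists_compact_pieces {E : Set Plane} (hE : IsRectifiable E)
    (hfin : Measure.hausdorffMeasure 1 E < ⊤) {θ : Plane → DirectionSpace}
    (hθ : IsTangentField E θ) {δ : ℝ} (hδ : 0 < δ) {η : ENNReal} (hη : η ≠ 0)
    (hη' : η ≠ ⊤) :
    ∃ (N : ℕ) (K : Fin N → Set Plane) (u : Fin N → DirectionSpace), (∀ i, IsCompact (K i)) ∧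
      (∀ i (β : ℝ), (β : DirectionSpace) = u i → ConeCondition δ β (K i)) ∧
      ∑ i, Measure.hausdorffMeasure 1 (K i) ≤ Measure.hausdorffMeasure 1 E ∧
      Measure.hausdorffMeasure 1 (E \ ⋃ i, {x ∈ K i | dist (θ x) (u i) < δ}) < η := by
  obtain ⟨Γ, hΓ, hnull⟩ := hE
  obtain ⟨A, u, hAc, hAcone, hAdir, hAcov⟩ := exists_short_arcs hΓ hδ
  choose γ hγ hγdir using hAdir
  set μ : Measure Plane := Measure.hausdorffMeasure 1 with hμ
  -- `E` need not be measurable: work in a measurable hull `H`, whose restricted measure `ν` agrees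
  -- with that of `E` on measurable sets because `μ E` is finite.
  set H := toMeasurable μ E with hH
  have hHm : MeasurableSet H := measurableSet_toMeasurable _ _
  have hHE : μ H = μ E := measure_toMeasurable _
  set ν := μ.restrict H with hν
  have hνfin : IsFiniteMeasure ν := ⟨by rw [hν, Measure.restrict_apply_univ, hHE]; exact hfin⟩
  have hνapp : ∀ s, MeasurableSet s → ν s = μ (E ∩ s) := fun s hs => by
    rw [hν, Measure.restrict_apply hs, inter_comm, Measure.measure_toMeasurable_inter hs hfin.ne]
  have hAm : ∀ n, MeasurableSet (A n) := fun n => (hAc n).measurableSet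
  have hDm : ∀ n, MeasurableSet (disjointed A n) := fun n => .disjointed hAm n
  have hAcc : ∀ n, MeasurableSet (accumulate A n) := fun n => by
    rw [accumulate_def]; exact .biUnion (to_countable _) fun j _ => hAm j
  have htail : Filter.Tendsto (fun n => ν (accumulate A n)ᶜ) Filter.atTop (nhds 0) := by
    have h0 : ν (⋂ n, (accumulate A n)ᶜ) = 0 := by
      rw [← compl_iUnion, iUnion_accumulate, hνapp _ (MeasurableSet.iUnion hAm).compl,
        ← sdiff_eq]
      exact measure_mono_null (sdiff_subset_sdiff_right hAcov) hnull
    rw [← h0]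
    refine tendsto_measure_iInter_atTop (fun n => ?_) ?_ ⟨0, measure_ne_top _ _⟩
    · exact (hAcc n).compl.nullMeasurableSet
    · exact fun a b hab => compl_subset_compl.2 (monotone_accumulate hab)
  -- Half of `η` pays for the arcs beyond the first `n + 1`, the other half for replacing these by
  -- compact subsets.
  have hη2 : 0 < η / 2 := ENNReal.half_pos hη
  obtain ⟨n, hn⟩ := (htail.eventually (gt_mem_nhds hη2)).exists
  have hηn : η / 2 / (n + 1 : ℕ) ≠ 0 :=
    (ENNReal.div_pos hη2.ne' (ENNReal.natCast_ne_top _)).ne'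
  have hpiece : ∀ i : Fin (n + 1), ∃ K ⊆ disjointed A i ∩ H, IsCompact K ∧
      ν ((disjointed A i ∩ H) \ K) < η / 2 / (n + 1 : ℕ) := fun i =>
    ((hDm i).inter hHm).exists_isCompact_sdiff_lt (measure_ne_top _ _) hηn
  choose K hKsub hKc hKν using hpiece
  have hKA : ∀ i, K i ⊆ A i := fun i x hx => disjointed_subset A i (hKsub i hx).1
  have hKH : ∀ i, K i ⊆ H := fun i x hx => (hKsub i hx).2
  refine ⟨n + 1, K, fun i => u i, hKc, fun i β hβ => ?_, ?_, ?_⟩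
  · exact fun x hx y hy => hAcone i β hβ x (hKA i hx) y (hKA i hy)
  · have hdisj : Pairwise (Function.onFun Disjoint K) := by
      intro i j hij
      have h1 : Disjoint (disjointed A i) (disjointed A j) :=
        disjoint_disjointed A (fun h => hij (Fin.ext h))
      exact h1.mono (fun x hx => (hKsub i hx).1) (fun x hx => (hKsub j hx).1)
    calc ∑ i, μ (K i) = μ (⋃ i, K i) := by
          rw [measure_iUnion hdisj fun i => (hKc i).measurableSet, tsum_fintype]
      _ ≤ μ H := measure_mono (iUnion_subset hKH)
      _ = μ E := hHE
  -- `Z` collects the points where `θ` disagrees with the tangent of one of the curves; off `Z`,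
  -- membership in `K i` forces `θ x` to be within `δ` of `u i`.
  · set Z : Set Plane := ⋃ i, {x ∈ E | ∃ t, γ i t = x ∧ direction (deriv (γ i) t) ≠ θ x} with hZ
    have hZ0 : μ Z = 0 := measure_iUnion_null fun i => hθ _ (hγ i)
    have hsub : E \ ⋃ i, {x ∈ K i | dist (θ x) (u i) < δ} ⊆ Z ∪
        (E ∩ ((accumulate A n)ᶜ ∪ ⋃ i, (disjointed A (i : Fin (n + 1)) ∩ H) \ K i)) := by
      rintro x ⟨hxE, hx⟩
      by_cases hxZ : x ∈ Z
      · exact Or.inl hxZ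
      refine Or.inr ⟨hxE, ?_⟩
      by_cases hxA : x ∈ accumulate A n
      · right
        obtain ⟨j, hj, hxj⟩ : ∃ j ≤ n, x ∈ disjointed A j := by
          rw [accumulate_def] at hxA
          obtain ⟨j, hj, hxj⟩ := mem_iUnion₂.1 hxA
          have hx' : x ∈ ⋃ i ∈ Finset.Iic n, disjointed A i := by
            rw [biUnion_Iic_disjointed, partialSups_eq_biSup]
            exact mem_iUnion₂.2 ⟨j, hj, hxj⟩
          obtain ⟨i, hi, hxi⟩ := mem_iUnion₂.1 hx'
          exact ⟨i, by simpa using hi, hxi⟩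
        refine mem_iUnion.2 ⟨⟨j, Nat.lt_succ_of_le hj⟩, ⟨hxj, subset_toMeasurable _ _ hxE⟩, ?_⟩
        intro hxK
        apply hx
        refine mem_iUnion.2 ⟨⟨j, Nat.lt_succ_of_le hj⟩, hxK, ?_⟩
        obtain ⟨t, ht, hd⟩ := hγdir j x (hKA _ hxK)
        have : direction (deriv (γ j) t) = θ x := by
          by_contra hne
          exact hxZ (mem_iUnion.2 ⟨j, hxE, t, ht, hne⟩)
        rwa [← this]
      · exact Or.inl hxA
    have hmeas : MeasurableSet ((accumulate A n)ᶜ ∪ ⋃ i, (disjointed A (i : Fin (n + 1)) ∩ H) \ K i) :=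
      (hAcc n).compl.union
        (MeasurableSet.iUnion fun i => ((hDm i).inter hHm).diff (hKc i).measurableSet)
    calc μ (E \ ⋃ i, {x ∈ K i | dist (θ x) (u i) < δ})
        ≤ μ Z + μ (E ∩ ((accumulate A n)ᶜ ∪ ⋃ i, (disjointed A (i : Fin (n + 1)) ∩ H) \ K i)) :=
          (measure_mono hsub).trans (measure_union_le _ _)
      _ = ν ((accumulate A n)ᶜ ∪ ⋃ i, (disjointed A (i : Fin (n + 1)) ∩ H) \ K i) := by
          rw [hZ0, zero_add, hνapp _ hmeas]
      _ ≤ ν (accumulate A n)ᶜ + ∑ i : Fin (n + 1), ν ((disjointed A i ∩ H) \ K i) :=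
          (measure_union_le _ _).trans (add_le_add le_rfl (measure_iUnion_fintype_le _ _))
      _ ≤ ν (accumulate A n)ᶜ + ∑ _i : Fin (n + 1), η / 2 / (n + 1 : ℕ) := by
          gcongr with i
          exact (hKν i).le
      _ = ν (accumulate A n)ᶜ + η / 2 := by
          rw [Finset.sum_const, Finset.card_univ, Fintype.card_fin, nsmul_eq_mul,
            ENNReal.mul_div_cancel (by simp) (ENNReal.natCast_ne_top _)]
      _ < η / 2 + η / 2 := by
          exact ENNReal.add_lt_add_right (ENNReal.div_ne_top hη' two_ne_zero) hn
      _ = η := ENNReal.add_halves η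

/-! ### Choice of parameters and conclusion -/

lemma pow_one_add_le_exp {c δ b : ℝ} {k : ℕ} (hc : 0 ≤ c) (hδ : 0 ≤ δ) (hk : k * δ ≤ b) :
    (1 + c * δ) ^ k ≤ Real.exp (c * b) := by
  calc (1 + c * δ) ^ k ≤ Real.exp (c * δ) ^ k := by
        refine pow_le_pow_left₀ (by positivity) ?_ k
        linarith [Real.add_one_le_exp (c * δ)]
    _ = Real.exp (c * (k * δ)) := by rw [← Real.exp_nat_mul]; congr 1; ring
    _ ≤ _ := by gcongr

/-- The zigzag controls directions at angle up to `π - ε₁` from `α`. The remaining ones are within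
`ε₁` of `α` modulo `π`, so they satisfy a cone condition with `2 * ε₁` about `α` and are cheap for
any path near the segment. -/
lemma exists_path_of_compact_pieces {ι : Type*} [Finite ι] {K : ι → Set Plane}
    {u : ι → DirectionSpace} {m : ι → ENNReal} {δ ε₁ ρ R α : ℝ} {k : ℕ}
    (hK : ∀ i, IsCompact (K i))
    (hcone : ∀ i (β : ℝ), (β : DirectionSpace) = u i → ConeCondition δ β (K i))
    (hm : ∀ i, Measure.hausdorffMeasure 1 (K i) < m i) (hR : 0 < R)
    (hδ : 0 < δ) (hε₁ : 0 < ε₁) (hε₁' : ε₁ ≤ 1) (hρ : ε₁ < ρ) (hk : k * δ = Real.pi - 2 * ε₁)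
    (hδε : δ * Real.exp (2 / Real.sin ε₁ * Real.pi) ≤ ε₁) :
    ∃ T ℓ, LabelledPath 0 (R • unitVec α) T ℓ ∧
      ℓ ≤ R * Real.exp (2 / Real.sin ε₁ * Real.pi) ∧
      ∀ i, volume (sweep T (remaining ρ (K i) (u i))) ≤ ENNReal.ofReal (16 * ε₁ * R) * m i := by
  have hsin : 0 < Real.sin ε₁ :=
    Real.sin_pos_of_pos_of_lt_pi hε₁ (by linarith [Real.pi_gt_three])
  have hpow : (1 + 2 / Real.sin ε₁ * δ) ^ k ≤ Real.exp (2 / Real.sin ε₁ * Real.pi) :=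
    pow_one_add_le_exp (by positivity) hδ.le (by linarith)
  have hexp : 1 ≤ Real.exp (2 / Real.sin ε₁ * Real.pi) := Real.one_le_exp (by positivity)
  set Λ := Real.exp (2 / Real.sin ε₁ * Real.pi)
  have hδε' : δ ≤ ε₁ := by nlinarith
  obtain ⟨η, hη, hcut⟩ := exists_pos_forall_volume_sweep_le (κ := 2 * ε₁) (α := α)
    (by positivity) hR.ne' hK hm
  obtain ⟨T, ℓ, hP, hℓ, hnear, hvol⟩ := exists_path_of_directions (ρ := ρ) hK hcone hm hδ hε₁ hρ
    (show 1 + 2 * δ / Real.sin ε₁ ≤ 1 + 2 / Real.sin ε₁ * δ from le_of_eq (by ring))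
    k α 1 R hR.ne' (Or.inl rfl) (by linarith) η hη
  rw [abs_of_pos hR] at hℓ hvol
  refine ⟨T, ℓ, hP, hℓ.trans (by gcongr), fun i => ?_⟩
  have : Fact (0 < Real.pi) := ⟨Real.pi_pos⟩
  obtain ⟨t, ⟨ht0, htπ⟩, ht⟩ := AddCircle.eq_coe_Ico (u i - (α : DirectionSpace))
  have hu : u i = ((α + t : ℝ) : DirectionSpace) := by
    rw [AddCircle.coe_add, ht, add_sub_cancel]
  rcases le_total t (Real.pi - ε₁) with h | h
  · refine (hvol i ⟨t, ⟨ht0, by linarith⟩, by rw [hu, one_mul]⟩).trans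
      (mul_le_mul_left (ENNReal.ofReal_le_ofReal ?_) _)
    calc R * (16 * δ * (1 + 2 / Real.sin ε₁ * δ) ^ k) ≤ R * (16 * δ * Λ) := by gcongr
      _ = 16 * (δ * Λ) * R := by ring
      _ ≤ 16 * ε₁ * R := by gcongr
  · have hβ : ((α + t - Real.pi : ℝ) : DirectionSpace) = u i := by
      rw [AddCircle.coe_sub, AddCircle.coe_period, sub_zero, hu]
    have hc : ConeCondition (2 * ε₁) α (K i) := by
      refine (hcone i _ hβ).rotate ?_
      rw [show α - (α + t - Real.pi) = Real.pi - t by ring, abs_of_nonneg (by linarith)]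
      linarith
    refine (hcut i hc T _ hnear fun φ x hx => hx.1).trans
      (mul_le_mul_left (ENNReal.ofReal_le_ofReal ?_) _)
    rw [abs_of_pos hR]
    linarith

lemma exists_labelledPath_of_ne_zero {E : Set Plane} (hE : IsRectifiable E)
    (hfin : Measure.hausdorffMeasure 1 E < ⊤) {θ : Plane → DirectionSpace}
    (hθ : IsTangentField E θ) {ε : ℝ} (hε : 0 < ε) {e : ℝ} (he : 0 < e) {z : Plane} (hz : z ≠ 0) :
    ∃ T ℓ, LabelledPath 0 z T ℓ ∧
      volume (sweep T fun φ => {x ∈ E | θ x ∉ Metric.ball φ ε}) < ENNReal.ofReal e := by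
  obtain ⟨R, α, -, hzα, hRz, -⟩ := exists_polar z
  have hR : 0 < R := by rw [hRz]; exact norm_pos_iff.2 hz
  set M : ℝ := (Measure.hausdorffMeasure 1 E).toReal + 1 with hM
  have hMpos : 0 < M := by positivity
  have hME : Measure.hausdorffMeasure 1 E + 1 = ENNReal.ofReal M := by
    rw [hM, ENNReal.ofReal_add ENNReal.toReal_nonneg zero_le_one, ENNReal.ofReal_toReal hfin.ne,
      ENNReal.ofReal_one]
  obtain ⟨ε₁, hε₁, hε₁1, hε₁ε, hε₁e⟩ : ∃ ε₁ : ℝ, 0 < ε₁ ∧ ε₁ ≤ 1 ∧ ε₁ ≤ ε / 4 ∧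
      16 * ε₁ * R * M ≤ e / 4 := by
    refine ⟨min (min 1 (ε / 4)) (e / (64 * (R * M))), by positivity,
      (min_le_left _ _).trans (min_le_left _ _), (min_le_left _ _).trans (min_le_right _ _), ?_⟩
    have h := min_le_right (min 1 (ε / 4)) (e / (64 * (R * M)))
    rw [le_div_iff₀ (by positivity)] at h
    linarith
  have hexp : 0 < Real.exp (2 / Real.sin ε₁ * Real.pi) := Real.exp_pos _
  set Λ := Real.exp (2 / Real.sin ε₁ * Real.pi) with hΛ
  have hsin : 0 < Real.sin ε₁ :=
    Real.sin_pos_of_pos_of_lt_pi hε₁ (by linarith [Real.pi_gt_three])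
  have hΛ1 : 1 ≤ Λ := Real.one_le_exp (by positivity)
  -- `Λ` depends only on `ε₁`, so enough stages make `δ * Λ ≤ ε₁`.
  obtain ⟨k, hk⟩ := exists_nat_gt (Real.pi * Λ / ε₁)
  have hk0 : (0 : ℝ) < k := lt_of_le_of_lt (by positivity) hk
  set δ : ℝ := (Real.pi - 2 * ε₁) / k with hδ
  have hδ0 : 0 < δ := div_pos (by linarith [Real.pi_gt_three]) hk0
  have hkδ : k * δ = Real.pi - 2 * ε₁ := mul_div_cancel₀ _ hk0.ne'
  have hδΛ : δ * Λ ≤ ε₁ := by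
    rw [div_lt_iff₀ hε₁] at hk
    rw [hδ, div_mul_eq_mul_div, div_le_iff₀ hk0]
    nlinarith
  have hδε : δ ≤ ε₁ := by nlinarith
  -- The path has length at most `R * Λ`, so the remainder sweeps at most `8 * (R * Λ) * η = e / 4`.
  set η : ℝ := e / (32 * (R * Λ)) with hη
  have hη0 : 0 < η := by positivity
  obtain ⟨N, K, u, hKc, hKcone, hKsum, hKrest⟩ := exists_compact_pieces hE hfin hθ hδ0
    (η := ENNReal.ofReal η) (by simpa using hη0) ENNReal.ofReal_ne_top
  -- Strict upper bounds are required; the slacks add up to at most `1`, the extra term in `M`.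
  set m : Fin N → ENNReal := fun i => Measure.hausdorffMeasure 1 (K i) + 1 / (N + 1 : ℕ) with hm
  have hKlt : ∀ i, Measure.hausdorffMeasure 1 (K i) < m i := fun i => by
    refine ENNReal.lt_add_right ?_ ?_
    · have h := Finset.single_le_sum (f := fun i => Measure.hausdorffMeasure 1 (K i))
        (fun _ _ => zero_le) (Finset.mem_univ i)
      exact ((h.trans hKsum).trans_lt hfin).ne
    · exact (ENNReal.div_pos one_ne_zero (ENNReal.natCast_ne_top _)).ne'
  have hmsum : ∑ i, m i ≤ ENNReal.ofReal M := by
    rw [← hME, hm, Finset.sum_add_distrib, Finset.sum_const, Finset.card_univ, Fintype.card_fin,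
      nsmul_eq_mul]
    refine add_le_add hKsum ?_
    rw [mul_one_div]
    exact ENNReal.div_le_of_le_mul (by rw [one_mul]; exact_mod_cast N.le_succ)
  obtain ⟨T, ℓ, hP, hℓ, hvol⟩ := exists_path_of_compact_pieces (ρ := ε / 2) (α := α) hKc hKcone
    hKlt hR hδ0 hε₁ hε₁1 (by linarith) hkδ hδΛ
  rw [← hzα] at hP
  refine ⟨T, ℓ, hP, ?_⟩
  set F := E \ ⋃ i, {x ∈ K i | dist (θ x) (u i) < δ} with hF
  have hsub : sweep T (fun φ => {x ∈ E | θ x ∉ Metric.ball φ ε}) ⊆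
      sweep T (fun _ => F) ∪ ⋃ i, sweep T (remaining (ε / 2) (K i) (u i)) := by
    intro a ha
    obtain ⟨p, φ, x, hpφ, ⟨hxE, hxφ⟩, rfl⟩ := mem_sweep.1 ha
    -- On a good piece, `θ x` is within `δ ≤ ε / 4` of `u i`, so a label within `ε / 2` of `u i` is
    -- within `ε` of `θ x`.
    by_cases hx : x ∈ ⋃ i, {x ∈ K i | dist (θ x) (u i) < δ}
    · right
      obtain ⟨i, hxK, hxu⟩ := mem_iUnion.1 hx
      refine mem_iUnion.2 ⟨i, mem_sweep.2 ⟨p, φ, x, hpφ, ⟨hxK, fun hball => hxφ ?_⟩, rfl⟩⟩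
      rw [Metric.mem_ball] at hball ⊢
      linarith [dist_triangle (θ x) (u i) φ]
    · exact Or.inl (mem_sweep.2 ⟨p, φ, x, hpφ, ⟨hxE, hx⟩, rfl⟩)
  calc volume (sweep T fun φ => {x ∈ E | θ x ∉ Metric.ball φ ε})
      ≤ volume (sweep T fun _ => F) + ∑ i, volume (sweep T (remaining (ε / 2) (K i) (u i))) :=
        (measure_mono hsub).trans
          ((measure_union_le _ _).trans (add_le_add le_rfl (measure_iUnion_fintype_le _ _)))
    _ ≤ ENNReal.ofReal (8 * ℓ) * ENNReal.ofReal η +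
          ∑ i, ENNReal.ofReal (16 * ε₁ * R) * m i :=
        add_le_add (hP.volume_sweep_le hKrest) (Finset.sum_le_sum fun i _ => hvol i)
    _ ≤ ENNReal.ofReal (8 * ℓ) * ENNReal.ofReal η +
          ENNReal.ofReal (16 * ε₁ * R) * ENNReal.ofReal M := by
        rw [← Finset.mul_sum]
        gcongr
    _ = ENNReal.ofReal (8 * ℓ * η + 16 * ε₁ * R * M) := by
        have := hP.length_nonneg
        rw [← ENNReal.ofReal_mul (by positivity), ← ENNReal.ofReal_mul (by positivity),
          ← ENNReal.ofReal_add (by positivity) (by positivity)]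
    _ < ENNReal.ofReal e := by
        rw [ENNReal.ofReal_lt_ofReal_iff he]
        have h1 : 8 * ℓ * η ≤ 8 * (R * Λ) * η := by gcongr
        have h2 : 8 * (R * Λ) * η = e / 4 := by rw [hη]; field_simp; norm_num
        linarith

lemma exists_labelledPath {E : Set Plane} (hE : IsRectifiable E)
    (hfin : Measure.hausdorffMeasure 1 E < ⊤) {θ : Plane → DirectionSpace}
    (hθ : IsTangentField E θ) {ε : ℝ} (hε : 0 < ε) (z : Plane) :
    ∃ T ℓ, LabelledPath 0 z T ℓ ∧
      volume (sweep T fun φ => {x ∈ E | θ x ∉ Metric.ball φ ε}) < ENNReal.ofReal ε := by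
  -- The construction needs a nonzero displacement; for `z = 0`, go out along a unit vector and
  -- back, with half the area for each trip.
  rcases eq_or_ne z 0 with rfl | hz
  · have hv : unitVec 0 ≠ 0 := by
      rw [← norm_ne_zero_iff, norm_unitVec]; exact one_ne_zero
    obtain ⟨T, ℓ, hP, hvol⟩ := exists_labelledPath_of_ne_zero hE hfin hθ hε (half_pos hε) hv
    obtain ⟨T', ℓ', hP', hvol'⟩ :=
      exists_labelledPath_of_ne_zero hE hfin hθ hε (half_pos hε) (neg_ne_zero.2 hv)
    have hP'' := hP'.shift (unitVec 0)
    rw [add_zero, add_neg_cancel] at hP''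
    refine ⟨_, _, hP.trans hP'', (volume_sweep_union_le _ _ _).trans_lt ?_⟩
    rw [volume_sweep_shift, ← add_halves ε, ENNReal.ofReal_add (half_pos hε).le (half_pos hε).le]
    rw [add_halves ε]
    exact ENNReal.add_lt_add hvol hvol'
  · exact exists_labelledPath_of_ne_zero hE hfin hθ hε hε hz

theorem mainTheorem3 (E : Set Plane) (hE : IsRectifiable E)
    (hfin : Measure.hausdorffMeasure 1 E < ⊤)
    (θ : Plane → DirectionSpace) (hθ : IsTangentField E θ)
    (ε : ℝ) (hε : 0 < ε) (z : Plane) :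
    ∃ (n : ℕ) (q : Fin (n + 1) → Plane) (φ : Fin n → DirectionSpace),
      0 < n ∧ q 0 = 0 ∧ q (Fin.last n) = z ∧
      volume (⋃ i : Fin n, ⋃ p ∈ segment ℝ (q i.castSucc) (q i.succ),
        (fun x => p + x) '' {x ∈ E | θ x ∉ Metric.ball (φ i) ε}) < ENNReal.ofReal ε := by
  obtain ⟨T, ℓ, hP, hvol⟩ := exists_labelledPath hE hfin hθ hε z
  obtain ⟨n, q, φ, hn, h0, hl, hT⟩ := hP.exists_fin
  refine ⟨n, q, φ, hn, h0, hl, (measure_mono ?_).trans_lt hvol⟩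
  intro a ha
  simp only [mem_iUnion] at ha
  obtain ⟨i, p, hp, x, hx, rfl⟩ := ha
  exact mem_sweep.2 ⟨p, φ i, x, hT i ⟨hp, rfl⟩, hx, rfl⟩
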